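/- **Lemma 5.4.** Let $S\subseteq\mathbb R^2$ be a connected open set and let $f:S\to S$ be a $C^1$ map, not necessarily invertible. For a map $h:S\to S$ and points $p,q\in S$, let $W^s_h(q)$ be the set of $x\in S$ with $h^n(x)\to q$ as $n\to\infty$, and let $W^u_h(p)$ be the set of $x\in S$ that have a backward orbit $(y_n)_{n\ge 0}$ in $S$ (that is, $y_0=x$ and $h(y_{n+1})=y_n$ for all $n$) with $y_n\to p$. A saddle point is a fixed point at which the map is differentiable, its derivative having one eigenvalue of modulus less than $1$ and one of modulus greater than $1$. Let $p,q\in S$ be saddle points of $f$, equal or distinct, joined by a homoclinic or heteroclinic curve $\gamma$: an open simple arc with a regular $C^1$ parametrization $\gamma:\mathbb R\to S$, not containing $p$ or $q$, with $\gamma(t)\to p$ as $t\to-\infty$ and $\gamma(t)\to q$ as $t\to+\infty$, which satisfies $f(\gamma)=\gamma$ and $\gamma\subseteq W^u_f(p)\cap W^s_f(q)$ and is contained in a compact subset of $S$. Let $u_{-1}\in\gamma$, and put $u_i:=f^{\,i+1}(u_{-1})\in\gamma$ for $i=0,1,2,3$, where $\gamma$ is parametrized in the direction of iteration, so that $u_{-1}$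 precedes $u_0$. Let $\kappa$ be the closed subarc of $\gamma$ from $u_{-1}$ to $u_3$, and suppose that there is a connected open set $U$ with $\kappa\subseteq U\subseteq S$ on which $f$ is invertible (i.e. injective). Then there are a point $v_0$ of $\gamma$ strictly between $u_0$ and $u_1$ and an open set $V\subseteq U$ with $u_1\notin V$ which contains the closed subarc $\sigma$ of $\kappa$ from $u_0$ to $v_0$, such that for every $\varepsilon>0$ there is a continuous map $g:S\to S$ with the following properties: $\|g(x)-f(x)\|<\varepsilon$ for all $x\in S$; $g=f$ on $S\setminus V$; $p$ and $q$ are saddle points of $g$; and $W^u_g(p)$ and $W^s_g(q)$ intersect transversally at some point $z\in f(\sigma)$, meaning that there are a $C^1$ arc in $W^u_g(p)$ and a $C^1$ arc in $W^s_g(q)$ through $z$ whose tangent vectors at $z$ are linearly independent. -/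

import Mathlib

open Set Filter Topology

/-- The Euclidean plane. -/
abbrev Plane : Type := EuclideanSpace ℝ (Fin 2)

/-- The stable set `W^s_f(q)` of a self-map `f` of `S`. -/
def stableSet (S : Set Plane) (f : Plane → Plane) (q : Plane) : Set Plane :=
  {x | x ∈ S ∧ Tendsto (fun n : ℕ => f^[n] x) atTop (𝓝 q)}

/-- The unstable set `W^u_f(p)` of a (not necessarily invertible) self-map `f` of `S`: the points
having a backward orbit `… ↦ y 2 ↦ y 1 ↦ y 0 = x` in `S` that converges to `p`. -/
def unstableSet (S : Set Plane) (f : Plane → Plane) (p : Plane) : Set Plane :=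
  {x | ∃ y : ℕ → Plane, y 0 = x ∧ (∀ n, y n ∈ S) ∧ (∀ n, f (y (n + 1)) = y n) ∧
    Tendsto y atTop (𝓝 p)}

/-- `p` is a saddle (fixed) point of `f`: one eigenvalue of the derivative lies inside and the
other one outside the unit circle (both are then real). -/
def IsSaddlePoint (f : Plane → Plane) (p : Plane) : Prop :=
  f p = p ∧ DifferentiableAt ℝ f p ∧ ∃ l m : ℝ, |l| < 1 ∧ 1 < |m| ∧
    Module.End.HasEigenvalue (fderiv ℝ f p).toLinearMap l ∧
    Module.End.HasEigenvalue (fderiv ℝ f p).toLinearMap m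

/-- `γ` is a regular `C¹` parametrization of an open simple arc, invariant under `f`, running from
`p` to `q` and contained in `W^u(p) ∩ W^s(q)`: a homoclinic curve if `p = q`, a heteroclinic curve
if `p ≠ q`. -/
structure IsConnectingCurve (S : Set Plane) (f : Plane → Plane) (p q : Plane)
    (γ : ℝ → Plane) : Prop where
  contDiff : ContDiff ℝ 1 γ
  regular : ∀ t, deriv γ t ≠ 0
  injective : Function.Injective γ
  tendsto_atBot : Tendsto γ atBot (𝓝 p)
  tendsto_atTop : Tendsto γ atTop (𝓝 q)
  left_notMem : p ∉ range γ
  right_notMem : q ∉ range γ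
  subset : range γ ⊆ unstableSet S f p ∩ stableSet S f q
  invariant : f '' range γ = range γ

/-- The sets `A` and `B` intersect transversally at `z`: they contain `C¹` arcs through `z` whose
tangent vectors at `z` are linearly independent, i.e. span the plane. -/
def IntersectTransverselyAt (A B : Set Plane) (z : Plane) : Prop :=
  ∃ α β : ℝ → Plane,
    ContDiffOn ℝ 1 α (Ioo (-1) 1) ∧ ContDiffOn ℝ 1 β (Ioo (-1) 1) ∧
    MapsTo α (Ioo (-1) 1) A ∧ MapsTo β (Ioo (-1) 1) B ∧
    α 0 = z ∧ β 0 = z ∧ LinearIndependent ℝ ![deriv α 0, deriv β 0]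

/-! On the parameter line `f` becomes a continuous surjection `φ` without fixed points, hence with
`t < φ t` throughout. So an orbit on the curve passes each fundamental domain only once, and `f` can
be bent near one point without disturbing what happens before or after. Let `V` be `U` minus the
closed ends of the curve, so that `V` meets the curve only at parameters in a short interval around
`b`. Put `g = f + δ θ w` with `θ` supported in `V`, zero at `γ s`, and of nonzero derivative along
the curve there. Backward orbits from near `γ s` avoid `V`, so `g ∘ γ` near `s` runs in the unstable
set of `g` (`apply_mem_unstableSet_of_eqOn`). Forward orbits from near `γ (φ s)` avoid `V`, so `γ`
itself still runs in the stable set (`mem_stableSet_of_eqOn`). The two arcs meet at `f (γ s)`; the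
area form of their tangents is affine in `δ` with nonzero slope, since `w` is transversal to the
curve at that point, so some arbitrarily small `δ` makes them independent. -/

/-- The union of a half-line of a curve with its limit is closed. -/
theorem isClosed_insert_image_Ici {γ : ℝ → Plane} (hγ : Continuous γ) {q : Plane}
    (hq : Tendsto γ atTop (𝓝 q)) (x : ℝ) : IsClosed (insert q (γ '' Ici x)) := by
  -- Folding the line by `|t|` makes both of its ends run to `q`, so adding `q` compactifies the
  -- image.
  have hrange : γ '' Ici x = range (fun t : ℝ => γ (x + |t|)) := by
    ext y
    constructor
    · rintro ⟨t, ht, rfl⟩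
      refine ⟨t - x, ?_⟩
      have : |t - x| = t - x := abs_of_nonneg (sub_nonneg.2 ht)
      simp [this]
    · rintro ⟨t, rfl⟩
      exact ⟨x + |t|, by simp, rfl⟩
  rw [hrange]
  refine (Tendsto.isCompact_insert_range_of_cocompact ?_ (by fun_prop)).isClosed
  refine hq.comp (tendsto_atTop_add_const_left _ x ?_)
  exact tendsto_norm_cocompact_atTop (E := ℝ)

theorem isClosed_insert_image_Iic {γ : ℝ → Plane} (hγ : Continuous γ) {p : Plane}
    (hp : Tendsto γ atBot (𝓝 p)) (x : ℝ) : IsClosed (insert p (γ '' Iic x)) := by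
  have h := isClosed_insert_image_Ici (γ := fun t => γ (-t)) (by fun_prop)
    (hp.comp tendsto_neg_atTop_atBot) (-x)
  have : (fun t => γ (-t)) '' Ici (-x) = γ '' Iic x := by
    rw [show (fun t => γ (-t)) = γ ∘ Neg.neg from rfl, image_comp]
    simp
  rwa [this] at h

/-! ### Dynamics on the parameter line -/

namespace IsConnectingCurve

variable {S : Set Plane} {f : Plane → Plane} {p q : Plane} {γ : ℝ → Plane}

theorem mem (hγ : IsConnectingCurve S f p q γ) (t : ℝ) : γ t ∈ S :=
  (hγ.subset (mem_range_self t)).2.1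

/-- The closure of the part of a connecting curve outside an open parameter interval. -/
def ends (_ : IsConnectingCurve S f p q γ) (l u : ℝ) : Set Plane :=
  insert p (γ '' Iic l) ∪ insert q (γ '' Ici u)

theorem isClosed_ends (hγ : IsConnectingCurve S f p q γ) (l u : ℝ) : IsClosed (hγ.ends l u) :=
  (isClosed_insert_image_Iic hγ.contDiff.continuous hγ.tendsto_atBot l).union
    (isClosed_insert_image_Ici hγ.contDiff.continuous hγ.tendsto_atTop u)

theorem mem_ends_iff (hγ : IsConnectingCurve S f p q γ) {l u t : ℝ} :
    γ t ∈ hγ.ends l u ↔ t ≤ l ∨ u ≤ t := by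
  have h1 : γ t ≠ p := fun h => hγ.left_notMem ⟨t, h⟩
  have h2 : γ t ≠ q := fun h => hγ.right_notMem ⟨t, h⟩
  simp only [ends, mem_union, mem_insert_iff, h1, h2, false_or,
    hγ.injective.mem_set_image, mem_Iic, mem_Ici]

/-- The map induced on the parameter line is continuous. -/
theorem continuous_of_semiconj (hγ : IsConnectingCurve S f p q γ) (hf : ContinuousOn f S)
    {φ : ℝ → ℝ} (hφ : ∀ t, γ (φ t) = f (γ t)) : Continuous φ := by
  have hc : Continuous fun t => γ (φ t) := by
    simp only [hφ]
    exact hf.comp_continuous hγ.contDiff.continuous hγ.mem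
  rw [continuous_iff_continuousAt]
  intro t
  refine (nhds_basis_Ioo (φ t)).tendsto_right_iff.2 ?_
  rintro ⟨l, u⟩ ⟨hl, hu⟩
  -- Removing the closed ends leaves an open set of the plane that cuts out exactly the parameters
  -- in `(l, u)`.
  have hmem : γ (φ t) ∈ (hγ.ends l u)ᶜ := by
    rw [mem_compl_iff, hγ.mem_ends_iff]
    push Not
    exact ⟨hl, hu⟩
  filter_upwards [hc.continuousAt.preimage_mem_nhds
    ((hγ.isClosed_ends l u).isOpen_compl.mem_nhds hmem)] with x hx
  rw [mem_preimage, mem_compl_iff, hγ.mem_ends_iff] at hx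
  push Not at hx
  exact hx

/-- The orbit of a fixed point is constant, yet tends to `q`, which is not on the curve. -/
theorem fixedPoint_free (hγ : IsConnectingCurve S f p q γ)
    {φ : ℝ → ℝ} (hφ : ∀ t, γ (φ t) = f (γ t)) (t : ℝ) : φ t ≠ t := by
  intro h
  have hfix : f (γ t) = γ t := by rw [← hφ, h]
  have ht := (hγ.subset (mem_range_self t)).2.2
  simp only [Function.iterate_fixed hfix] at ht
  exact hγ.right_notMem ⟨t, tendsto_nhds_unique tendsto_const_nhds ht⟩

/-- By the intermediate value theorem `φ t - t`, which never vanishes, keeps its sign. -/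
theorem lt_of_semiconj (hγ : IsConnectingCurve S f p q γ)
    {φ : ℝ → ℝ} (hφ : ∀ t, γ (φ t) = f (γ t)) (hc : Continuous φ) {a : ℝ} (ha : a < φ a)
    (t : ℝ) : t < φ t := by
  by_contra! h
  obtain ⟨x, hx⟩ := mem_range_of_exists_le_of_exists_ge (f := fun t => φ t - t) (c := 0)
    (by fun_prop) ⟨t, sub_nonpos.2 h⟩ ⟨a, sub_nonneg.2 ha.le⟩
  exact hγ.fixedPoint_free hφ x (sub_eq_zero.1 hx)

/-- Iterating a right inverse of the parameter map leads to the beginning of the curve. -/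
theorem tendsto_iterate_rightInverse (hγ : IsConnectingCurve S f p q γ)
    {φ ψ : ℝ → ℝ} (hφ : ∀ t, γ (φ t) = f (γ t)) (hc : Continuous φ) (hlt : ∀ t, t < φ t)
    (hψ : ∀ t, φ (ψ t) = t) (t : ℝ) : Tendsto (fun n => ψ^[n] t) atTop atBot := by
  have hanti : Antitone fun n => ψ^[n] t := antitone_nat_of_succ_le fun n => by
    rw [Function.iterate_succ_apply']
    exact (hlt _).le.trans_eq (hψ _)
  rcases tendsto_atTop_of_antitone hanti with h | ⟨l, hl⟩
  · exact h
  -- A finite limit of the decreasing sequence would be a fixed point of `φ`.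
  · refine absurd ?_ (hγ.fixedPoint_free hφ l)
    have h1 := (hc.tendsto l).comp (hl.comp (tendsto_add_atTop_nat 1))
    refine tendsto_nhds_unique h1 (hl.congr fun n => ?_)
    simp [Function.iterate_succ_apply', hψ]

/-- Points of the curve stay in the stable set if the map is changed only off their orbit. -/
theorem mem_stableSet_of_eqOn (hγ : IsConnectingCurve S f p q γ) {g : Plane → Plane}
    {φ : ℝ → ℝ} (hφ : ∀ t, γ (φ t) = f (γ t)) (hlt : ∀ t, t < φ t) {u : ℝ}
    (hg : ∀ t, u ≤ t → g (γ t) = f (γ t)) {t : ℝ} (ht : u ≤ t) : γ t ∈ stableSet S g q := by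
  have key : ∀ n : ℕ, ∃ x, u ≤ x ∧ g^[n] (γ t) = γ x ∧ f^[n] (γ t) = γ x := by
    intro n
    induction n with
    | zero => exact ⟨t, ht, rfl, rfl⟩
    | succ n ih =>
      obtain ⟨x, hx, h1, h2⟩ := ih
      refine ⟨φ x, hx.trans (hlt x).le, ?_, ?_⟩
      · rw [Function.iterate_succ_apply', h1, hg x hx, hφ]
      · rw [Function.iterate_succ_apply', h2, hφ]
  refine ⟨hγ.mem t, (hγ.subset (mem_range_self t)).2.2.congr fun n => ?_⟩
  obtain ⟨x, -, h1, h2⟩ := key n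
  rw [h1, h2]

/-- The image of a point of the curve lies in the unstable set of a map that differs from the
original one only off the backward orbit of that point. -/
theorem apply_mem_unstableSet_of_eqOn (hγ : IsConnectingCurve S f p q γ) {g : Plane → Plane}
    (hgS : MapsTo g S S) {φ ψ : ℝ → ℝ} (hφ : ∀ t, γ (φ t) = f (γ t)) (hc : Continuous φ)
    (hlt : ∀ t, t < φ t) (hψ : ∀ t, φ (ψ t) = t) {l : ℝ}
    (hg : ∀ t, t ≤ l → g (γ t) = f (γ t)) {t : ℝ} (ht : ψ t ≤ l) :
    g (γ t) ∈ unstableSet S g p := by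
  have hle : ∀ n : ℕ, ψ^[n + 1] t ≤ l := by
    intro n
    induction n with
    | zero => exact ht
    | succ n ih =>
      rw [Function.iterate_succ_apply']
      exact ((hlt _).le.trans_eq (hψ _)).trans ih
  -- Only the last step, from `γ t` to `g (γ t)`, may differ from `f`; all earlier points lie where
  -- `g = f`.
  refine ⟨fun n => Nat.casesOn n (g (γ t)) fun k => γ (ψ^[k] t), rfl, ?_, ?_, ?_⟩
  · rintro (_ | n)
    · exact hgS (hγ.mem t)
    · exact hγ.mem _
  · rintro (_ | n)
    · rfl
    · change g (γ (ψ^[n + 1] t)) = γ (ψ^[n] t)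
      rw [hg _ (hle n), ← hφ, Function.iterate_succ_apply', hψ]
  · rw [← tendsto_add_atTop_iff_nat 1]
    exact hγ.tendsto_atBot.comp (hγ.tendsto_iterate_rightInverse hφ hc hlt hψ t)

end IsConnectingCurve

/-! ### Transversality and small perturbations in the plane -/

theorem IsSaddlePoint.congr {f g : Plane → Plane} {p : Plane} (hp : IsSaddlePoint f p)
    (h : g =ᶠ[𝓝 p] f) : IsSaddlePoint g p := by
  obtain ⟨h1, h2, h3⟩ := hp
  refine ⟨by rw [h.eq_of_nhds, h1], h2.congr_of_eventuallyEq h, ?_⟩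
  rwa [h.fderiv_eq]

/-- The area form of the plane, in its first argument. -/
def crossWith (v : Plane) : Plane →ₗ[ℝ] ℝ where
  toFun u := u 0 * v 1 - u 1 * v 0
  map_add' x y := by simp; ring
  map_smul' c x := by simp; ring

theorem linearIndependent_of_crossWith_ne_zero {u v : Plane} (h : crossWith v u ≠ 0) :
    LinearIndependent ℝ ![u, v] := by
  rw [LinearIndependent.pair_iff]
  intro x y hxy
  have h0 := congrArg (fun z : Plane => z 0) hxy
  have h1 := congrArg (fun z : Plane => z 1) hxy
  simp only [PiLp.add_apply, PiLp.smul_apply, smul_eq_mul, PiLp.zero_apply] at h0 h1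
  simp only [crossWith, LinearMap.coe_mk, AddHom.coe_mk] at h
  constructor
  · exact (mul_eq_zero.1 (show x * (u 0 * v 1 - u 1 * v 0) = 0 by
      linear_combination v 1 * h0 - v 0 * h1)).resolve_right h
  · exact (mul_eq_zero.1 (show y * (u 0 * v 1 - u 1 * v 0) = 0 by
      linear_combination u 0 * h1 - u 1 * h0)).resolve_right h

theorem exists_crossWith_ne_zero {v : Plane} (hv : v ≠ 0) : ∃ w, crossWith v w ≠ 0 := by
  refine ⟨!₂[v 1, -v 0], fun h => hv ?_⟩
  simp only [crossWith, LinearMap.coe_mk, AddHom.coe_mk, Matrix.cons_val_zero,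
    Matrix.cons_val_one] at h
  ext i
  fin_cases i
  · change v 0 = 0
    nlinarith [mul_self_nonneg (v 0), mul_self_nonneg (v 1)]
  · change v 1 = 0
    nlinarith [mul_self_nonneg (v 0), mul_self_nonneg (v 1)]

/-- A bump function times a linear one: a compactly supported function near `x`, vanishing at `x`,
whose derivative at `x` is positive in the direction `w`. -/
theorem exists_localized_linear {O : Set Plane} (hO : IsOpen O) {x w : Plane} (hx : x ∈ O)
    (hw : w ≠ 0) : ∃ θ : Plane → ℝ, ContDiff ℝ 1 θ ∧ HasCompactSupport θ ∧ tsupport θ ⊆ O ∧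
      θ x = 0 ∧ fderiv ℝ θ x w ≠ 0 := by
  obtain ⟨r, hr, hrO⟩ := Metric.nhds_basis_closedBall.mem_iff.1 (hO.mem_nhds hx)
  let B : ContDiffBump x := ⟨r / 2, r, half_pos hr, half_lt_self hr⟩
  have hcd : ContDiff ℝ 1 fun y => B y * inner ℝ w (y - x) :=
    B.contDiff.mul (contDiff_const.inner ℝ (contDiff_id.sub contDiff_const))
  refine ⟨fun y => B y * inner ℝ w (y - x), hcd, B.hasCompactSupport.mul_right, ?_, by simp, ?_⟩
  · refine (tsupport_mul_subset_left (f := B)).trans ?_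
    rw [B.tsupport_eq]
    exact hrO
  · have h1 : (fun y => B y * inner ℝ w (y - x)) =ᶠ[𝓝 x] fun y => innerSL ℝ w (y - x) := by
      filter_upwards [B.eventuallyEq_one] with y hy
      simp [hy]
    have h2 : HasFDerivAt (fun y => innerSL ℝ w (y - x)) (innerSL ℝ w) x :=
      (innerSL ℝ w).hasFDerivAt.comp x ((hasFDerivAt_id x).sub_const x)
    rw [h1.fderiv_eq, h2.fderiv]
    simpa using hw

/-- Small multiples of a compactly supported perturbation preserve an open set. -/
theorem exists_small_perturbation {S : Set Plane} (hS : IsOpen S) {f : Plane → Plane}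
    (hf : ContinuousOn f S) (hfS : MapsTo f S S) {θ : Plane → ℝ} (hθ : Continuous θ)
    (hc : HasCompactSupport θ) (hθS : tsupport θ ⊆ S) (w : Plane) {ε : ℝ} (hε : 0 < ε) :
    ∃ δ₀ > 0, ∀ δ, 0 < δ → δ ≤ δ₀ → MapsTo (fun x => f x + (δ * θ x) • w) S S ∧
      ∀ x ∈ S, ‖(f x + (δ * θ x) • w) - f x‖ < ε := by
  have hK : IsCompact (f '' tsupport θ) := IsCompact.image_of_continuousOn hc (hf.mono hθS)
  obtain ⟨ρ, hρ, hρS⟩ := hK.exists_thickening_subset_open hS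
    (image_subset_iff.2 fun x hx => hfS (hθS hx))
  obtain ⟨C, hC⟩ := hc.exists_bound_of_continuous hθ
  have hC0 : 0 ≤ C := (norm_nonneg _).trans (hC 0)
  have hm : 0 < min ε ρ := lt_min hε hρ
  have hpos : 0 < C * ‖w‖ + 1 := by positivity
  refine ⟨min ε ρ / (C * ‖w‖ + 1), by positivity, fun δ hδ hle => ?_⟩
  have hsmall : ∀ x, ‖(δ * θ x) • w‖ < min ε ρ := by
    intro x
    rw [norm_smul, norm_mul, Real.norm_of_nonneg hδ.le]
    calc δ * ‖θ x‖ * ‖w‖ ≤ δ * C * ‖w‖ := by gcongr; exact hC x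
      _ < δ * (C * ‖w‖ + 1) := by nlinarith
      _ ≤ min ε ρ := (le_div_iff₀ hpos).1 hle
  refine ⟨fun x hx => ?_, fun x _ => ?_⟩
  · by_cases h : x ∈ tsupport θ
    · refine hρS (Metric.mem_thickening_iff.2 ⟨f x, mem_image_of_mem f h, ?_⟩)
      rw [dist_eq_norm, add_sub_cancel_left]
      exact (hsmall x).trans_le (min_le_right _ _)
    · simpa [image_eq_zero_of_notMem_tsupport h] using hfS hx
  · rw [add_sub_cancel_left]
    exact (hsmall x).trans_le (min_le_left _ _)

/-- A nonconstant affine function has at most one zero, so `δ₀` or `δ₀ / 2` works. -/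
theorem exists_pos_le_add_mul_ne_zero (A : ℝ) {k δ₀ : ℝ} (hk : k ≠ 0) (hδ : 0 < δ₀) :
    ∃ δ, 0 < δ ∧ δ ≤ δ₀ ∧ A + δ * k ≠ 0 := by
  by_cases h : A + δ₀ * k = 0
  · refine ⟨δ₀ / 2, half_pos hδ, half_le_self hδ.le, fun h' => ?_⟩
    have : δ₀ * k = 0 := by linarith
    exact mul_ne_zero hδ.ne' hk this
  · exact ⟨δ₀, hδ, le_rfl, h⟩

/-- Curves parametrized by arbitrary intervals witness transversality. -/
theorem IntersectTransverselyAt.of_curves {A B : Set Plane} {z : Plane} {α β : ℝ → Plane}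
    {s t r : ℝ} (hr : 0 < r) (hα : ContDiff ℝ 1 α) (hβ : ContDiff ℝ 1 β)
    (hA : ∀ x, |x - s| < r → α x ∈ A) (hB : ∀ x, |x - t| < r → β x ∈ B)
    (hαs : α s = z) (hβt : β t = z) (h : crossWith (deriv β t) (deriv α s) ≠ 0) :
    IntersectTransverselyAt A B z := by
  have habs : ∀ c x : ℝ, x ∈ Ioo (-1 : ℝ) 1 → |r * x + c - c| < r := by
    intro c x hx
    rw [add_sub_cancel_right, abs_mul, abs_of_pos hr]
    nlinarith [abs_lt.2 hx]
  have hderiv : ∀ (η : ℝ → Plane) (c : ℝ), ContDiff ℝ 1 η →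
      deriv (fun x => η (r * x + c)) 0 = r • deriv η c := by
    intro η c hη
    have h1 : HasDerivAt (fun x : ℝ => r * x + c) r 0 := by
      simpa using ((hasDerivAt_id (0 : ℝ)).const_mul r).add_const c
    have h2 : HasDerivAt η (deriv η c) (r * 0 + c) := by
      rw [mul_zero, zero_add]
      exact (hη.differentiable one_ne_zero c).hasDerivAt
    exact (h2.scomp 0 h1).deriv
  refine ⟨fun x => α (r * x + s), fun x => β (r * x + t), ?_, ?_, fun x hx => hA _ (habs s x hx),
    fun x hx => hB _ (habs t x hx), by simpa, by simpa, ?_⟩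
  · exact (hα.comp ((contDiff_const.mul contDiff_id).add contDiff_const)).contDiffOn
  · exact (hβ.comp ((contDiff_const.mul contDiff_id).add contDiff_const)).contDiffOn
  · rw [hderiv α s hα, hderiv β t hβ]
    refine linearIndependent_of_crossWith_ne_zero ?_
    have : crossWith (r • deriv β t) (r • deriv α s)
        = r * r * crossWith (deriv β t) (deriv α s) := by
      simp [crossWith]
      ring
    rw [this]
    exact mul_ne_zero (mul_ne_zero hr.ne' hr.ne') h

/-- The points `u₋₁, u₀, u₁, u₂, u₃` are `γ a, γ b, γ c, γ d, γ e`; the subarc `κ` is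
`γ '' Icc a e`, and `σ` is `γ '' Icc b v`. -/
theorem lemma5p4
    (S : Set Plane) (hSo : IsOpen S) (hSc : IsConnected S)
    (f : Plane → Plane) (hf : ContDiffOn ℝ 1 f S) (hfS : MapsTo f S S)
    (p q : Plane) (hpS : p ∈ S) (hqS : q ∈ S)
    (hp : IsSaddlePoint f p) (hq : IsSaddlePoint f q)
    (γ : ℝ → Plane) (hγ : IsConnectingCurve S f p q γ)
    (K : Set Plane) (hK : IsCompact K) (hKS : K ⊆ S) (hγK : range γ ⊆ K)
    (a b c d e : ℝ) (hab : a < b)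
    (h₀ : f (γ a) = γ b) (h₁ : f (γ b) = γ c) (h₂ : f (γ c) = γ d) (h₃ : f (γ d) = γ e)
    (U : Set Plane) (hUo : IsOpen U) (hUc : IsConnected U) (hUS : U ⊆ S)
    (hκU : γ '' Icc a e ⊆ U) (hinv : InjOn f U) :
    ∃ (v : ℝ) (V : Set Plane), b < v ∧ v < c ∧
      IsOpen V ∧ V ⊆ U ∧ γ '' Icc b v ⊆ V ∧ γ c ∉ V ∧
      ∀ ε : ℝ, 0 < ε → ∃ g : Plane → Plane,
        MapsTo g S S ∧ ContinuousOn g S ∧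
        (∀ x ∈ S, ‖g x - f x‖ < ε) ∧
        (∀ x ∈ S \ V, g x = f x) ∧
        IsSaddlePoint g p ∧ IsSaddlePoint g q ∧
        ∃ z ∈ f '' (γ '' Icc b v),
          IntersectTransverselyAt (unstableSet S g p) (stableSet S g q) z := by
  have hγd : Differentiable ℝ γ := hγ.contDiff.differentiable one_ne_zero
  choose φ hφ using fun t => hγ.invariant.subset (mem_image_of_mem f (mem_range_self (f := γ) t))
  have hφc : Continuous φ := hγ.continuous_of_semiconj hf.continuousOn hφ
  have hφa : φ a = b := hγ.injective ((hφ a).trans h₀)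
  have hφb : φ b = c := hγ.injective ((hφ b).trans h₁)
  have hφcd : φ c = d := hγ.injective ((hφ c).trans h₂)
  have hφd : φ d = e := hγ.injective ((hφ d).trans h₃)
  have hlt : ∀ t, t < φ t := hγ.lt_of_semiconj hφ hφc (hab.trans_eq hφa.symm)
  have hbc : b < c := (hlt b).trans_eq hφb
  have hce : c < e := ((hlt c).trans_eq hφcd).trans ((hlt d).trans_eq hφd)
  have hpre : ∀ t, ∃ x, φ x = t := by
    intro t
    obtain ⟨_, ⟨x, rfl⟩, hx⟩ := hγ.invariant.symm.subset (mem_range_self t)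
    exact ⟨x, hγ.injective ((hφ x).trans hx)⟩
  choose ψ hψ using hpre
  -- Since `φ b = c`, a small interval around `b` is carried by `φ` entirely beyond itself.
  obtain ⟨η, hη, hηc, hηφ⟩ : ∃ η, 0 < η ∧ b + η < c ∧ ∀ x, |x - b| < η → b + η < φ x := by
    have hev : ∀ᶠ x in 𝓝 b, (b + c) / 2 < φ x :=
      hφc.continuousAt.eventually (lt_mem_nhds (by rw [hφb]; linarith))
    obtain ⟨r, hr, hball⟩ := Metric.eventually_nhds_iff.1 hev
    refine ⟨min r ((c - b) / 2), lt_min hr (by linarith), ?_, fun x hx => ?_⟩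
    · linarith [min_le_right r ((c - b) / 2)]
    · have := hball (y := x) (by rw [Real.dist_eq]; exact hx.trans_le (min_le_left _ _))
      linarith [min_le_right r ((c - b) / 2)]
  -- A preimage of `t` inside the interval around `b` would be sent beyond `b + η`, hence past `t`.
  have hψle : ∀ t, t < b + η → ψ t ≤ b - η := by
    intro t ht
    by_contra! h
    have h1 : ψ t < t := (hlt _).trans_eq (hψ t)
    have h2 := hηφ (ψ t) (abs_lt.2 ⟨by linarith, by linarith⟩)
    rw [hψ] at h2
    linarith
  have hVo : IsOpen (U \ hγ.ends (b - η) (b + η)) := hUo.sdiff (hγ.isClosed_ends _ _)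
  have hκV : ∀ t ∈ Icc b (b + η / 2), γ t ∈ U \ hγ.ends (b - η) (b + η) := by
    rintro t ⟨ht1, ht2⟩
    refine ⟨hκU ⟨t, ⟨by linarith, by linarith⟩, rfl⟩, ?_⟩
    rw [hγ.mem_ends_iff]
    push Not
    constructor <;> linarith
  refine ⟨b + η / 2, U \ hγ.ends (b - η) (b + η), by linarith, by linarith, hVo, sdiff_subset,
    image_subset_iff.2 hκV, fun h => h.2 (hγ.mem_ends_iff.2 (Or.inr hηc.le)), fun ε hε => ?_⟩
  set V := U \ hγ.ends (b - η) (b + η)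
  have hVS : V ⊆ S := sdiff_subset.trans hUS
  set s := b + η / 4 with hs
  have hsV : γ s ∈ V := hκV s ⟨by linarith, by linarith⟩
  obtain ⟨w, hw⟩ := exists_crossWith_ne_zero (hγ.regular (φ s))
  obtain ⟨θ, hθ, hθc, hθV, hθ0, hθ1⟩ := exists_localized_linear hVo hsV (hγ.regular s)
  obtain ⟨δ₀, hδ₀, hsmall⟩ := exists_small_perturbation hSo hf.continuousOn hfS hθ.continuous hθc
    (hθV.trans hVS) w hε
  -- The quantity kept nonzero is the area form of the tangents of `g ∘ γ` at `s` and of `γ` at `φ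
  -- s`.
  obtain ⟨δ, hδ, hδle, hne⟩ := exists_pos_le_add_mul_ne_zero
    (crossWith (deriv γ (φ s)) (deriv (fun t => f (γ t)) s)) (mul_ne_zero hθ1 hw) hδ₀
  obtain ⟨hgS, hgε⟩ := hsmall δ hδ hδle
  set g : Plane → Plane := fun x => f x + (δ * θ x) • w with hg
  have hgout : ∀ x, x ∉ V → g x = f x := fun x hx => by
    simp [hg, image_eq_zero_of_notMem_tsupport (fun h => hx (hθV h))]
  have hgnear : ∀ x, x ∉ V → g =ᶠ[𝓝 x] f := fun x hx => by
    filter_upwards [(isClosed_tsupport θ).isOpen_compl.mem_nhds fun h => hx (hθV h)] with y hy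
    simp [hg, image_eq_zero_of_notMem_tsupport hy]
  have hgleft : ∀ t, t ≤ b - η → g (γ t) = f (γ t) := fun t ht =>
    hgout _ fun h => h.2 (hγ.mem_ends_iff.2 (Or.inl ht))
  have hgright : ∀ t, b + η ≤ t → g (γ t) = f (γ t) := fun t ht =>
    hgout _ fun h => h.2 (hγ.mem_ends_iff.2 (Or.inr ht))
  have hfγ : ContDiff ℝ 1 fun t => f (γ t) := hf.comp_contDiff hγ.contDiff hγ.mem
  have hgγ : ContDiff ℝ 1 fun t => g (γ t) :=
    hfγ.add ((contDiff_const.mul (hθ.comp hγ.contDiff)).smul contDiff_const)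
  have hderiv : deriv (fun t => g (γ t)) s
      = deriv (fun t => f (γ t)) s + (δ * fderiv ℝ θ (γ s) (deriv γ s)) • w := by
    have h1 : HasDerivAt (fun t => θ (γ t)) (fderiv ℝ θ (γ s) (deriv γ s)) s :=
      (hθ.differentiable one_ne_zero (γ s)).hasFDerivAt.comp_hasDerivAt s (hγd s).hasDerivAt
    exact ((hfγ.differentiable one_ne_zero s).hasDerivAt.add
      ((h1.const_mul δ).smul_const w)).deriv
  have hφs : b + η < φ s := hηφ s (by
    rw [hs, add_sub_cancel_left, abs_of_pos (by linarith)]; linarith)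
  refine ⟨g, hgS, ?_, hgε, fun x hx => hgout x hx.2, hp.congr (hgnear p ?_), hq.congr (hgnear q ?_),
    f (γ s), mem_image_of_mem f (mem_image_of_mem γ ⟨by linarith, by linarith⟩), ?_⟩
  · exact hf.continuousOn.add
      ((continuousOn_const.mul hθ.continuous.continuousOn).smul continuousOn_const)
  · exact fun h => h.2 (Or.inl (mem_insert _ _))
  · exact fun h => h.2 (Or.inr (mem_insert _ _))
  -- The radius keeps the first parameter below `b + η` and the second above it.
  · refine IntersectTransverselyAt.of_curves (α := fun t => g (γ t)) (β := γ) (s := s) (t := φ s)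
      (r := min (η / 4) (φ s - (b + η))) (lt_min (by linarith) (by linarith)) hgγ hγ.contDiff
      (fun x hx => ?_) (fun x hx => ?_) ?_ (hφ s) ?_
    · have h1 := (abs_lt.1 (hx.trans_le (min_le_left _ _))).2
      exact hγ.apply_mem_unstableSet_of_eqOn hgS hφ hφc hlt hψ hgleft (hψle x (by linarith))
    · have h1 := (abs_lt.1 (hx.trans_le (min_le_right _ _))).1
      exact hγ.mem_stableSet_of_eqOn hφ hlt hgright (by linarith)
    · simp [hg, hθ0]
    · rw [hderiv, map_add, map_smul, smul_eq_mul, mul_assoc]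
      exact hne
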